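/- There exists a universal constant $C>0$ such that the following holds. Let $n\ge 1$ be an integer, let $p>0$ be real, and let $Z=(Z_1,\dots,Z_n)$ be a random vector in $\mathbb{R}^n$ with the standard normal distribution. Let $\mathbb{M}\sum_{i=1}^n|Z_i|^p$ denote any median of $\sum_{i=1}^n|Z_i|^p$. Then for all $t>0$, with probability at least $1-C\exp(-t^2/2)$, \[ \left|\sum_{i=1}^{n}|Z_i|^{p}-\mathbb{M}\sum_{i=1}^{n}|Z_i|^{p}\right|\le \begin{cases} Cn^{1/2}t, & 0<p\le 1,\\ Cn^{1/2}t+Cn^{1/4}t^{3/2}, & 1\le p\le 3/2,\\ Cn^{1/2}t+Cn^{1-p/2}t^{p}, & 3/2\le p\le 2,\\ C2^{p}\max\left\{\left(\mathbb{E}|Z_1|^{2(p-1)}\right)^{1/2}n^{1/2}t,\ t^{p}\right\}, & 2\le p<\infty. \end{cases} \] (At the common endpoints $p=1,\,3/2,\,2$ both of the corresponding bounds hold.) -/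

import Mathlib

open MeasureTheory ProbabilityTheory

/-- `m` is a median of the real random variable `X` under `P`. -/
def IsMedian {Ω : Type*} [MeasurableSpace Ω] (X : Ω → ℝ) (P : Measure Ω) (m : ℝ) : Prop :=
  1 / 2 ≤ P.real {ω | X ω ≤ m} ∧ 1 / 2 ≤ P.real {ω | m ≤ X ω}

/-! The sum is first shown to concentrate around its mean: outside an event of probability at most
`4 * exp (-t ^ 2 / 2)` the deviation is at most some `D t` increasing in `t`.
`IsMedian.concentration` then replaces the mean by any median, at the cost of doubling `D t`.

For `p ≤ 2` put `u = t / √n`. A Chernoff bound with parameter of size at most `1 / 8` gives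
sub-Gaussian tails while `u ≤ 1` (`stdNormalPi_bernstein`). For `u > 1`, `abs_rpow_le_add` compares
the sum with the sum of squares, whose tail is elementary.

For `p ≥ 2` the lower tail is sub-Gaussian because the summands are nonnegative, but for `p > 2` the
summands have no positive exponential moments. They are truncated at level `a` with `a ^ 2 = t ^ 2 +
2 * log n`, the level at which the union bound over coordinates costs only `2 * exp (-t ^ 2 / 2)`.
Below it the Chernoff parameter may go up to `a ^ (2 - p) / 4`. That this range suffices is
`le_rpow_mul_max_of_level`: either `a` is comparable to `t` and the term `t ^ p` pays, or `n` is so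
large that the moment term pays. -/

/-- The standard normal distribution on the real line. -/
noncomputable abbrev stdNormal : Measure ℝ := gaussianReal 0 1

/-! ### Gaussian absolute moments and tails in one dimension -/

theorem gaussianPDFReal_zero_one (x : ℝ) :
    gaussianPDFReal 0 1 x = (Real.sqrt (2 * Real.pi))⁻¹ * Real.exp (-(1 / 2) * x ^ 2) := by
  simp only [gaussianPDFReal, NNReal.coe_one, mul_one, sub_zero]
  congr 2; ring

theorem integral_stdNormal (f : ℝ → ℝ) :
    ∫ x, f x ∂stdNormal
      = (Real.sqrt (2 * Real.pi))⁻¹ * ∫ x, f x * Real.exp (-(1 / 2) * x ^ 2) := by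
  rw [integral_gaussianReal_eq_integral_smul (by norm_num), ← integral_const_mul]
  refine integral_congr_ae (.of_forall fun x => ?_)
  simp only [gaussianPDFReal_zero_one, smul_eq_mul]
  ring

theorem integrable_stdNormal_of (f : ℝ → ℝ)
    (h : Integrable fun x => f x * Real.exp (-(1 / 2) * x ^ 2)) : Integrable f stdNormal := by
  rw [stdNormal, gaussianReal_of_var_ne_zero _ (by norm_num),
    integrable_withDensity_iff (measurable_gaussianPDF 0 1) (by simp [gaussianPDF])]
  simp only [toReal_gaussianPDF, gaussianPDFReal_zero_one]
  refine (h.const_mul (Real.sqrt (2 * Real.pi))⁻¹).congr (.of_forall fun x => ?_)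
  simp only; ring

theorem integral_abs_rpow_mul_exp {q b : ℝ} (hq : 0 ≤ q) (hb : 0 < b) :
    ∫ x : ℝ, |x| ^ q * Real.exp (-b * x ^ 2)
      = b ^ (-(q + 1) / 2) * Real.Gamma ((q + 1) / 2) := by
  have h1 : ∫ x : ℝ, |x| ^ q * Real.exp (-b * x ^ 2)
      = 2 * ∫ x in Set.Ioi (0 : ℝ), x ^ q * Real.exp (-b * x ^ (2 : ℝ)) := by
    have := integral_comp_abs (f := fun x : ℝ => x ^ q * Real.exp (-b * x ^ (2 : ℝ)))
    simpa using this
  rw [h1, integral_rpow_mul_exp_neg_mul_rpow two_pos (by linarith) hb]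
  ring

theorem integrable_abs_rpow_mul_exp {q b : ℝ} (hq : 0 ≤ q) (hb : 0 < b) :
    Integrable fun x : ℝ => |x| ^ q * Real.exp (-b * x ^ 2) := by
  -- A non-integrable function has integral `0` by convention, whereas the Gamma formula gives a
  -- positive value.
  by_contra h
  have h1 := integral_abs_rpow_mul_exp hq hb
  rw [integral_undef h] at h1
  have h2 := Real.Gamma_pos_of_pos (s := (q + 1) / 2) (by linarith)
  have : 0 < b ^ (-(q + 1) / 2) * Real.Gamma ((q + 1) / 2) := by positivity
  linarith

theorem integrable_abs_rpow_mul_exp_stdNormal {q : ℝ} (hq : 0 ≤ q) :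
    Integrable (fun x : ℝ => |x| ^ q * Real.exp (x ^ 2 / 4)) stdNormal := by
  refine integrable_stdNormal_of _ ((integrable_abs_rpow_mul_exp hq
    (b := 1 / 4) (by norm_num)).congr (.of_forall fun x => ?_))
  simp only [mul_assoc, ← Real.exp_add]
  congr 2; ring

theorem integrable_abs_rpow_stdNormal {q : ℝ} (hq : 0 ≤ q) :
    Integrable (fun x : ℝ => |x| ^ q) stdNormal :=
  integrable_stdNormal_of _ (integrable_abs_rpow_mul_exp hq (by norm_num))

/-- This controls the second-order term of the Chernoff bounds by the moment in the theorem. Both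
sides are Gamma values whose arguments differ by one; the factor `p - 1 / 2` from the recursion is
absorbed by a power of two. -/
theorem integral_abs_rpow_mul_exp_stdNormal_le {p : ℝ} (hp : 1 ≤ p) :
    ∫ x, |x| ^ (2 * p) * Real.exp (x ^ 2 / 4) ∂stdNormal
      ≤ 4 * 4 ^ p * ∫ x, |x| ^ (2 * (p - 1)) ∂stdNormal := by
  rw [integral_stdNormal, integral_stdNormal,
    integral_abs_rpow_mul_exp (by linarith) (by norm_num)]
  have h1 : ∫ x : ℝ, |x| ^ (2 * p) * Real.exp (x ^ 2 / 4) * Real.exp (-(1 / 2) * x ^ 2)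
      = ∫ x : ℝ, |x| ^ (2 * p) * Real.exp (-(1 / 4) * x ^ 2) := by
    refine integral_congr_ae (.of_forall fun x => ?_)
    simp only [mul_assoc, ← Real.exp_add]
    congr 2; ring
  rw [h1, integral_abs_rpow_mul_exp (by linarith) (by norm_num)]
  have h2 : (2 * p + 1) / 2 = (2 * (p - 1) + 1) / 2 + 1 := by ring
  have hs : 0 < (2 * (p - 1) + 1) / 2 := by linarith
  rw [h2, Real.Gamma_add_one hs.ne']
  have hG := Real.Gamma_pos_of_pos hs
  have h3 : (1 / 4 : ℝ) ^ (-(2 * p + 1) / 2) = 2 * 4 ^ p := by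
    rw [show (1 / 4 : ℝ) = 4⁻¹ by norm_num, Real.inv_rpow (by norm_num),
      ← Real.rpow_neg (by norm_num), show -(-(2 * p + 1) / 2) = p + 1 / 2 by ring,
      Real.rpow_add (by norm_num), ← Real.sqrt_eq_rpow,
      show (4 : ℝ) = 2 ^ 2 by norm_num, Real.sqrt_sq (by norm_num)]
    ring
  have h4 : (1 / 2 : ℝ) ^ (-(2 * (p - 1) + 1) / 2) = 2 ^ (p - 1 / 2) := by
    rw [show (1 / 2 : ℝ) = 2⁻¹ by norm_num, Real.inv_rpow (by norm_num),
      ← Real.rpow_neg (by norm_num)]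
    congr 1; ring
  have h5 : p - 1 / 2 ≤ 2 * 2 ^ (p - 1 / 2) := by
    have := one_add_mul_self_le_rpow_one_add (s := 1) (by norm_num) hp
    have h8 : (2 : ℝ) ^ p = 2 ^ (p - 1 / 2) * Real.sqrt 2 := by
      rw [Real.sqrt_eq_rpow, ← Real.rpow_add two_pos]; congr 1; ring
    have h9 : Real.sqrt 2 ≤ 2 := by
      rw [Real.sqrt_le_left (by norm_num)]; norm_num
    norm_num at this
    have : 0 < (2 : ℝ) ^ (p - 1 / 2) := by positivity
    nlinarith
  rw [h3, h4]
  have hp4 : (0 : ℝ) < 4 ^ p := by positivity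
  have hpi : 0 ≤ (Real.sqrt (2 * Real.pi))⁻¹ := by positivity
  have key : 2 * 4 ^ p * ((2 * (p - 1) + 1) / 2 * Real.Gamma ((2 * (p - 1) + 1) / 2))
      ≤ 4 * 4 ^ p * (2 ^ (p - 1 / 2) * Real.Gamma ((2 * (p - 1) + 1) / 2)) := by
    have : (2 * (p - 1) + 1) / 2 ≤ 2 * 2 ^ (p - 1 / 2) := by
      have : 0 < (2 : ℝ) ^ (p - 1 / 2) := by positivity
      linarith
    have := mul_le_mul_of_nonneg_right this (mul_pos hp4 hG).le
    linarith
  have := mul_le_mul_of_nonneg_left key hpi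
  linarith

/-- Only the mass of `[u, u + 1]` is kept, with `(u + 1) ^ 2 ≤ 3 * u ^ 2 + 3 / 2` in the exponent.
-/
theorem integral_abs_rpow_stdNormal_lower {q u : ℝ} (hq : 0 ≤ q) (hu : 0 ≤ u) :
    (Real.sqrt (2 * Real.pi))⁻¹ * Real.exp (-(3 / 4)) * (u ^ q * Real.exp (-(3 / 2) * u ^ 2))
      ≤ ∫ x, |x| ^ q ∂stdNormal := by
  rw [integral_stdNormal, mul_assoc]
  gcongr
  have hint := integrable_abs_rpow_mul_exp hq (b := 1 / 2) (by norm_num)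
  calc Real.exp (-(3 / 4)) * (u ^ q * Real.exp (-(3 / 2) * u ^ 2))
      = ∫ _ in Set.Icc u (u + 1), Real.exp (-(3 / 4)) * (u ^ q * Real.exp (-(3 / 2) * u ^ 2)) := by
        simp
    _ ≤ ∫ x in Set.Icc u (u + 1), |x| ^ q * Real.exp (-(1 / 2) * x ^ 2) := by
        refine setIntegral_mono_on (integrableOn_const (by simp)) hint.integrableOn measurableSet_Icc fun x hx => ?_
        have hx0 : 0 ≤ x := hu.trans hx.1
        rw [abs_of_nonneg hx0, mul_left_comm, ← Real.exp_add]
        gcongr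
        · exact hx.1
        · have : x ^ 2 ≤ (u + 1) ^ 2 := by gcongr; exact hx.2
          nlinarith [sq_nonneg (2 * u - 1)]
    _ ≤ _ := setIntegral_le_integral hint (.of_forall fun x => by positivity)

theorem stdNormal_abs_gt_le {a : ℝ} (ha : 0 ≤ a) :
    stdNormal.real {x | a < |x|} ≤ 2 * Real.exp (-a ^ 2 / 2) := by
  have h1 : stdNormal.real {x | a ≤ x} ≤ Real.exp (-a ^ 2 / 2) := by
    have := measure_ge_le_exp_mul_mgf (μ := stdNormal) (X := id) a ha
      (integrable_exp_mul_gaussianReal a)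
    rw [mgf_id_gaussianReal] at this
    refine this.trans (le_of_eq ?_)
    rw [← Real.exp_add]; congr 1; simp; ring
  have h2 : stdNormal.real {x | x ≤ -a} ≤ Real.exp (-a ^ 2 / 2) := by
    have := measure_le_le_exp_mul_mgf (μ := stdNormal) (X := id) (t := -a) (-a) (by linarith)
      (integrable_exp_mul_gaussianReal (-a))
    rw [mgf_id_gaussianReal] at this
    refine this.trans (le_of_eq ?_)
    rw [← Real.exp_add]; congr 1; simp; ring
  calc stdNormal.real {x | a < |x|} ≤ stdNormal.real ({x | a ≤ x} ∪ {x | x ≤ -a}) := by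
        refine measureReal_mono fun x hx => ?_
        rcases lt_abs.1 (Set.mem_ofPred_eq ▸ hx) with h | h
        · exact Or.inl h.le
        · exact Or.inr (by simp only [Set.mem_ofPred_eq]; linarith)
    _ ≤ _ := (measureReal_union_le _ _).trans (by linarith)

/-! ### Chernoff bound for product measure and elementary exponential inequalities -/

/-- The law of `n` independent standard normal variables. -/
noncomputable abbrev stdNormalPi (n : ℕ) : Measure (Fin n → ℝ) := Measure.pi fun _ => stdNormal

theorem stdNormalPi_chernoff {n : ℕ} {g : ℝ → ℝ}
    (hint : Integrable (fun x => Real.exp (g x)) stdNormal) (s : ℝ) :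
    (stdNormalPi n).real {x | s ≤ ∑ i, g (x i)}
      ≤ Real.exp (-s) * (∫ x, Real.exp (g x) ∂stdNormal) ^ n := by
  have h := measure_ge_le_exp_mul_mgf (μ := stdNormalPi n) (X := fun x => ∑ i, g (x i)) (t := 1) s
    zero_le_one (by
      simp only [one_mul, Real.exp_sum]
      exact Integrable.fintype_prod (fun _ => hint))
  refine h.trans (le_of_eq ?_)
  simp only [mgf, one_mul, Real.exp_sum, neg_mul]
  rw [integral_fintype_prod_eq_pow (fun x => Real.exp (g x)), Fintype.card_fin]

theorem exp_le_one_add_add_sq_mul_exp_abs (x : ℝ) :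
    Real.exp x ≤ 1 + x + x ^ 2 * Real.exp |x| := by
  have h := Complex.norm_exp_sub_sum_le_norm_mul_exp (x : ℂ) 2
  simp only [Finset.sum_range_succ, Finset.range_zero, Finset.sum_empty, pow_zero, pow_one,
    Nat.factorial, Nat.cast_one, div_one, zero_add, mul_one] at h
  have h2 : Complex.exp x - (1 + x) = ((Real.exp x - (1 + x) : ℝ) : ℂ) := by push_cast; rfl
  rw [h2, Complex.norm_real, Complex.norm_real, Real.norm_eq_abs, Real.norm_eq_abs, sq_abs] at h
  linarith [le_abs_self (Real.exp x - (1 + x))]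

theorem exp_neg_le_quadratic {x : ℝ} (hx : 0 ≤ x) : Real.exp (-x) ≤ 1 - x + x ^ 2 / 2 := by
  have h := Real.quadratic_le_exp_of_nonneg hx
  have h1 : Real.exp (-x) * Real.exp x = 1 := by rw [← Real.exp_add]; simp
  have h2 := Real.exp_pos (-x)
  have h3 : Real.exp (-x) * (1 + x + x ^ 2 / 2) ≤ 1 := by nlinarith
  have h4 : 0 < 1 + x + x ^ 2 / 2 := by positivity
  rw [← le_div_iff₀ h4] at h3
  refine h3.trans ?_
  rw [div_le_iff₀ h4]
  -- `(1 - x + x ^ 2 / 2) * (1 + x + x ^ 2 / 2) = 1 + x ^ 4 / 4`.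
  nlinarith [sq_nonneg (x ^ 2)]

/-! ### Concentration around the mean for exponents at most two -/

theorem integrable_exp_sq_stdNormal :
    Integrable (fun x : ℝ => Real.exp (x ^ 2 / 4)) stdNormal := by
  simpa using integrable_abs_rpow_mul_exp_stdNormal le_rfl

theorem integral_exp_sq_stdNormal_le : ∫ x, Real.exp (x ^ 2 / 4) ∂stdNormal ≤ Real.exp 1 := by
  have h1 : ∫ x : ℝ, Real.exp (x ^ 2 / 4) * Real.exp (-(1 / 2) * x ^ 2)
      = ∫ x : ℝ, Real.exp (-(1 / 4) * x ^ 2) := by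
    refine integral_congr_ae (.of_forall fun x => ?_)
    simp only [← Real.exp_add]
    congr 1; ring
  rw [integral_stdNormal, h1, integral_gaussian, ← Real.sqrt_inv, ← Real.sqrt_mul (by positivity)]
  have : (2 * Real.pi)⁻¹ * (Real.pi / (1 / 4)) = 2 := by
    field_simp; norm_num
  rw [this]
  refine le_trans ?_ (Real.add_one_le_exp 1)
  rw [Real.sqrt_le_left (by norm_num)]; norm_num

theorem integral_sq_stdNormal : ∫ x : ℝ, x ^ 2 ∂stdNormal = 1 := by
  have h := variance_eq_integral (μ := stdNormal) (X := id) aemeasurable_id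
  rw [variance_id_gaussianReal] at h
  simpa using h.symm

theorem integrable_sq_stdNormal : Integrable (fun x : ℝ => x ^ 2) stdNormal := by
  simpa using integrable_abs_rpow_stdNormal (q := 2) (by norm_num)

theorem abs_rpow_le_add {p r : ℝ} (hp2 : p ≤ 2) (hp : 0 ≤ p) (hr : 0 < r) (x : ℝ) :
    |x| ^ p ≤ r ^ p + r ^ (p - 2) * x ^ 2 := by
  rcases le_or_gt |x| r with h | h
  · have := Real.rpow_le_rpow (abs_nonneg x) h hp
    have : 0 ≤ r ^ (p - 2) * x ^ 2 := by positivity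
    linarith
  · have h0 : 0 < |x| := hr.trans h
    have h1 : |x| ^ p = |x| ^ (p - 2) * x ^ 2 := by
      rw [← sq_abs x, ← Real.rpow_natCast |x| 2, ← Real.rpow_add h0]; congr 1; push_cast; ring
    have h2 : |x| ^ (p - 2) ≤ r ^ (p - 2) :=
      Real.rpow_le_rpow_of_nonpos hr h.le (by linarith)
    have : 0 ≤ r ^ p := by positivity
    rw [h1]
    nlinarith [sq_nonneg x]

theorem integral_abs_rpow_le_two {p : ℝ} (hp : 0 ≤ p) (hp2 : p ≤ 2) :
    ∫ x, |x| ^ p ∂stdNormal ≤ 2 := by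
  calc ∫ x, |x| ^ p ∂stdNormal ≤ ∫ x, (1 + x ^ 2) ∂stdNormal := by
        refine integral_mono (integrable_abs_rpow_stdNormal hp)
          ((integrable_const _).add integrable_sq_stdNormal) fun x => ?_
        simpa using abs_rpow_le_add hp2 hp one_pos x
    _ = 2 := by
        rw [integral_add (integrable_const _) integrable_sq_stdNormal, integral_sq_stdNormal]
        norm_num

/-- With `y = |x| ^ p - m` one has `|y| ≤ 3 + x ^ 2`. Both `y ^ 2` and `exp |l * y|` cost a factor
`exp (|y| / 8)`, and `exp (|y| / 4)` is still integrable. -/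
theorem exp_sub_le_of_le_two {p l m : ℝ} (hp : 0 ≤ p) (hp2 : p ≤ 2) (hl : |l| ≤ 1 / 8)
    (hm0 : 0 ≤ m) (hm : m ≤ 2) (x : ℝ) :
    Real.exp (l * (|x| ^ p - m))
      ≤ 1 + l * (|x| ^ p - m) + l ^ 2 * (128 * Real.exp 1 * Real.exp (x ^ 2 / 4)) := by
  refine (exp_le_one_add_add_sq_mul_exp_abs _).trans ?_
  set y := |x| ^ p - m with hy
  have hx := abs_rpow_le_add hp2 hp one_pos x
  simp only [Real.one_rpow, one_mul] at hx
  have hx0 : 0 ≤ |x| ^ p := by positivity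
  have hyb : |y| ≤ 3 + x ^ 2 := abs_le.2 ⟨by nlinarith [sq_nonneg x], by linarith⟩
  have h1 : |l * y| ≤ |y| / 8 := by
    rw [abs_mul]; nlinarith [abs_nonneg y]
  have h2 : y ^ 2 ≤ 128 * Real.exp (|y| / 8) := by
    have := Real.quadratic_le_exp_of_nonneg (x := |y| / 8) (by positivity)
    have h3 := sq_abs y
    nlinarith [abs_nonneg y]
  have h4 : Real.exp (|y| / 8) * Real.exp |l * y| ≤ Real.exp 1 * Real.exp (x ^ 2 / 4) := by
    rw [← Real.exp_add, ← Real.exp_add]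
    exact Real.exp_le_exp.2 (by linarith)
  have h5 : y ^ 2 * Real.exp |l * y| ≤ 128 * Real.exp 1 * Real.exp (x ^ 2 / 4) := by
    have := mul_le_mul_of_nonneg_right h2 (Real.exp_pos |l * y|).le
    linarith
  have := mul_le_mul_of_nonneg_left h5 (sq_nonneg l)
  rw [mul_pow]
  linarith

theorem integrable_exp_sub_of_le_two {p l m : ℝ} (hp : 0 ≤ p) (hp2 : p ≤ 2) (hl : |l| ≤ 1 / 8)
    (hm0 : 0 ≤ m) (hm : m ≤ 2) :
    Integrable (fun x => Real.exp (l * (|x| ^ p - m))) stdNormal := by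
  refine Integrable.mono' (g := fun x => 1 + l * (|x| ^ p - m)
      + l ^ 2 * (128 * Real.exp 1 * Real.exp (x ^ 2 / 4))) ?_
    (Measurable.aestronglyMeasurable (by fun_prop)) (.of_forall fun x => ?_)
  · exact ((integrable_const _).add
      (((integrable_abs_rpow_stdNormal hp).sub (integrable_const _)).const_mul _)).add
      ((integrable_exp_sq_stdNormal.const_mul _).const_mul _)
  · rw [Real.norm_of_nonneg (Real.exp_pos _).le]
    exact exp_sub_le_of_le_two hp hp2 hl hm0 hm x

theorem integral_exp_sub_le_of_le_two {p l : ℝ} (hp : 0 ≤ p) (hp2 : p ≤ 2) (hl : |l| ≤ 1 / 8) :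
    ∫ x, Real.exp (l * (|x| ^ p - ∫ y, |y| ^ p ∂stdNormal)) ∂stdNormal
      ≤ Real.exp (1000 * l ^ 2) := by
  set m := ∫ y, |y| ^ p ∂stdNormal with hmdef
  have hm0 : 0 ≤ m := integral_nonneg fun x => by positivity
  have hm : m ≤ 2 := integral_abs_rpow_le_two hp hp2
  have hi1 : Integrable (fun x : ℝ => l * (|x| ^ p - m)) stdNormal :=
    ((integrable_abs_rpow_stdNormal hp).sub (integrable_const _)).const_mul _
  have hi2 : Integrable (fun x : ℝ => l ^ 2 * (128 * Real.exp 1 * Real.exp (x ^ 2 / 4)))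
      stdNormal := (integrable_exp_sq_stdNormal.const_mul _).const_mul _
  have hi3 : Integrable (fun x : ℝ => 1 + l * (|x| ^ p - m)) stdNormal :=
    (integrable_const _).add hi1
  have h := integral_mono (integrable_exp_sub_of_le_two hp hp2 hl hm0 hm) (hi3.add hi2)
    (exp_sub_le_of_le_two hp hp2 hl hm0 hm)
  refine h.trans ?_
  simp only [Pi.add_apply]
  rw [integral_add hi3 hi2, integral_add (integrable_const _) hi1, integral_const_mul,
    integral_sub (integrable_abs_rpow_stdNormal hp) (integrable_const _), integral_const_mul,
    integral_const_mul]
  simp only [integral_const, probReal_univ, smul_eq_mul, one_mul, ← hmdef, sub_self, mul_zero,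
    add_zero]
  -- `128 * e ^ 2` is about `946`.
  have h1 : 128 * Real.exp 1 * ∫ x, Real.exp (x ^ 2 / 4) ∂stdNormal ≤ 1000 := by
    have h2 := Real.exp_one_lt_d9
    have h3 := integral_exp_sq_stdNormal_le
    have h4 := Real.exp_pos 1
    nlinarith
  have := mul_le_mul_of_nonneg_left h1 (sq_nonneg l)
  linarith [Real.add_one_le_exp (1000 * l ^ 2)]

theorem stdNormalPi_sum_sq_ge {n : ℕ} {t : ℝ} (h : (n : ℝ) ≤ t ^ 2) :
    (stdNormalPi n).real {x | 6 * t ^ 2 ≤ ∑ i, x i ^ 2} ≤ Real.exp (-t ^ 2 / 2) := by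
  have h1 := stdNormalPi_chernoff (n := n) integrable_exp_sq_stdNormal (6 * t ^ 2 / 4)
  simp only [← Finset.sum_div, div_le_div_iff_of_pos_right (show (0 : ℝ) < 4 by norm_num)] at h1
  refine h1.trans ?_
  have h2 : (∫ x, Real.exp (x ^ 2 / 4) ∂stdNormal) ^ n ≤ Real.exp n := by
    rw [← mul_one (n : ℝ), Real.exp_nat_mul]
    exact pow_le_pow_left₀ (integral_nonneg fun x => by positivity) integral_exp_sq_stdNormal_le n
  refine (mul_le_mul_of_nonneg_left h2 (Real.exp_pos _).le).trans ?_
  rw [← Real.exp_add]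
  gcongr
  linarith

theorem stdNormalPi_bernstein {n : ℕ} {p u e : ℝ} (hp : 0 ≤ p) (hp2 : p ≤ 2) (hu : 0 ≤ u)
    (hu1 : u ≤ 1) (he : e = 1 ∨ e = -1) :
    (stdNormalPi n).real {x | 130 * n * u ≤ e * (∑ i, |x i| ^ p - n * ∫ y, |y| ^ p ∂stdNormal)}
      ≤ Real.exp (-(n * u ^ 2) / 2) := by
  rcases hu.eq_or_lt with rfl | hu
  · simp [measureReal_le_one]
  have he1 : |e| = 1 := by rcases he with rfl | rfl <;> simp
  have he2 : e ^ 2 = 1 := by rw [← sq_abs, he1]; norm_num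
  set m := ∫ y, |y| ^ p ∂stdNormal with hmdef
  have hm0 : 0 ≤ m := integral_nonneg fun x => by positivity
  have hm : m ≤ 2 := integral_abs_rpow_le_two hp hp2
  -- With Chernoff parameter `± u / 8` the exponent is `n * u ^ 2 * (1000 / 64 - 130 / 8)`, below
  -- `-(n * u ^ 2) / 2`.
  have hl : |e * (u / 8)| ≤ 1 / 8 := by
    rw [abs_mul, he1, abs_of_nonneg (by positivity)]; linarith
  have h1 := stdNormalPi_chernoff (n := n) (integrable_exp_sub_of_le_two hp hp2 hl hm0 hm)
    (130 * n * u * (u / 8))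
  have hset : {x : Fin n → ℝ | 130 * n * u ≤ e * (∑ i, |x i| ^ p - n * m)}
      = {x | 130 * n * u * (u / 8) ≤ ∑ i, e * (u / 8) * (|x i| ^ p - m)} := by
    ext x
    simp only [Set.mem_ofPred_eq, ← Finset.mul_sum, Finset.sum_sub_distrib, Finset.sum_const,
      Finset.card_univ, Fintype.card_fin, nsmul_eq_mul]
    rw [mul_right_comm e, mul_le_mul_iff_left₀ (by positivity)]
  rw [hset]
  refine h1.trans ?_
  have h2 := pow_le_pow_left₀ (integral_nonneg fun x => (Real.exp_pos _).le)
    (integral_exp_sub_le_of_le_two hp hp2 hl) n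
  refine (mul_le_mul_of_nonneg_left h2 (Real.exp_pos _).le).trans ?_
  rw [← Real.exp_nat_mul, ← Real.exp_add]
  gcongr
  rw [mul_pow, he2]
  have : (0 : ℝ) ≤ n * u ^ 2 := by positivity
  nlinarith

theorem stdNormalPi_concentration_of_le_two {n : ℕ} (hn : 0 < n) {p t : ℝ} (hp : 0 ≤ p)
    (hp2 : p ≤ 2) (ht : 0 < t) :
    (stdNormalPi n).real {x | 130 * n * max (t / √n) ((t / √n) ^ max p 1)
        < |∑ i, |x i| ^ p - n * ∫ y, |y| ^ p ∂stdNormal|}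
      ≤ 2 * Real.exp (-t ^ 2 / 2) := by
  have hn' : (0 : ℝ) < n := by exact_mod_cast hn
  set u := t / √n with hudef
  have hu : 0 < u := by positivity
  have hut : n * u ^ 2 = t ^ 2 := by
    rw [hudef, div_pow, Real.sq_sqrt hn'.le]; field_simp
  set m := ∫ y, |y| ^ p ∂stdNormal with hmdef
  -- For `u ≤ 1` the linear term of the maximum is enough. For `u > 1`, off the event of large `∑ x
  -- i ^ 2`, both the sum and its mean are `O(n * u ^ p)`.
  rcases le_or_gt u 1 with h | h
  · have hsub : {x : Fin n → ℝ | 130 * n * max u (u ^ max p 1) < |∑ i, |x i| ^ p - n * m|}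
        ⊆ {x | 130 * n * u ≤ 1 * (∑ i, |x i| ^ p - n * m)}
          ∪ {x | 130 * n * u ≤ -1 * (∑ i, |x i| ^ p - n * m)} := by
      intro x hx
      have hx' : 130 * n * u < |∑ i, |x i| ^ p - n * m| :=
        lt_of_le_of_lt (by gcongr; exact le_max_left _ _) (Set.mem_ofPred_eq ▸ hx)
      rcases lt_abs.1 hx' with h | h
      · exact Or.inl (by simp only [Set.mem_ofPred_eq]; linarith)
      · exact Or.inr (by simp only [Set.mem_ofPred_eq]; linarith)
    refine (measureReal_mono hsub).trans ((measureReal_union_le _ _).trans ?_)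
    have h1 := stdNormalPi_bernstein (n := n) hp hp2 hu.le h (Or.inl rfl)
    have h2 := stdNormalPi_bernstein (n := n) hp hp2 hu.le h (Or.inr rfl)
    rw [hut] at h1 h2
    linarith
  · have hu1 : 1 ≤ u ^ p := Real.one_le_rpow h.le hp
    have hnt : (n : ℝ) ≤ t ^ 2 := by
      rw [← hut]
      exact le_mul_of_one_le_right hn'.le (one_le_pow₀ h.le)
    refine (measureReal_mono (fun x hx => ?_)).trans ((stdNormalPi_sum_sq_ge (n := n) hnt).trans
      (by linarith [Real.exp_pos (-t ^ 2 / 2)]))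
    by_contra hcon
    simp only [Set.mem_ofPred_eq, not_le] at hx hcon
    refine absurd hx (not_lt.2 ?_)
    have hm0 : 0 ≤ m := integral_nonneg fun x => by positivity
    have hm : m ≤ 2 := integral_abs_rpow_le_two hp hp2
    have hS0 : 0 ≤ ∑ i, |x i| ^ p := Finset.sum_nonneg fun i _ => by positivity
    have hS : ∑ i, |x i| ^ p ≤ 7 * (n * u ^ p) := by
      calc ∑ i, |x i| ^ p ≤ ∑ i, (u ^ p + u ^ (p - 2) * x i ^ 2) :=
            Finset.sum_le_sum fun i _ => abs_rpow_le_add hp2 hp hu _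
        _ = n * u ^ p + u ^ (p - 2) * ∑ i, x i ^ 2 := by
            simp [Finset.sum_add_distrib, ← Finset.mul_sum]
        _ ≤ n * u ^ p + u ^ (p - 2) * (6 * (n * u ^ 2)) := by
            rw [hut]; gcongr
        _ = 7 * (n * u ^ p) := by
            have : u ^ p = u ^ (p - 2) * u ^ 2 := by
              rw [← Real.rpow_natCast u 2, ← Real.rpow_add hu]; congr 1; push_cast; ring
            rw [this]; ring
    have h1 : (n : ℝ) * 1 ≤ n * u ^ p := by gcongr
    have h2 : 130 * n * u ^ p ≤ 130 * n * max u (u ^ max p 1) := by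
      gcongr
      exact le_max_of_le_right (Real.rpow_le_rpow_of_exponent_le h.le (le_max_left _ _))
    have h3 : n * m ≤ n * 2 := by gcongr
    have h4 : 0 ≤ n * m := by positivity
    exact abs_le.2 ⟨by linarith, by linarith⟩

/-! ### Concentration around the mean for exponents at least two -/

/-- The function `|x| ^ p` set to zero where `|x|` exceeds the level `a`. -/
noncomputable def truncAbsRpow (a p x : ℝ) : ℝ := if |x| ≤ a then |x| ^ p else 0

theorem measurable_truncAbsRpow (a p : ℝ) : Measurable (truncAbsRpow a p) :=
  Measurable.ite (measurableSet_le (by fun_prop) (by fun_prop)) (by fun_prop) (by fun_prop)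

theorem truncAbsRpow_nonneg (a p x : ℝ) : 0 ≤ truncAbsRpow a p x := by
  unfold truncAbsRpow; split_ifs <;> positivity

theorem truncAbsRpow_le (a p x : ℝ) : truncAbsRpow a p x ≤ |x| ^ p := by
  unfold truncAbsRpow; split_ifs
  · exact le_rfl
  · positivity

theorem abs_rpow_sq (p x : ℝ) : (|x| ^ p) ^ 2 = |x| ^ (2 * p) := by
  rw [← Real.rpow_mul_natCast (abs_nonneg x)]; congr 1; push_cast; ring

/-- Below the level, `|x| ^ p ≤ a ^ (p - 2) * x ^ 2`; this fixes the range of admissible Chernoff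
parameters. -/
theorem mul_truncAbsRpow_le {a p l : ℝ} (hp : 2 ≤ p) (ha : 0 < a)
    (hl : l ≤ a ^ (2 - p) / 4) (x : ℝ) : l * truncAbsRpow a p x ≤ x ^ 2 / 4 := by
  unfold truncAbsRpow
  split_ifs with h
  · have h1 : |x| ^ p = |x| ^ (p - 2) * x ^ 2 := by
      rw [← sq_abs x, ← Real.rpow_natCast |x| 2,
        ← Real.rpow_add_of_nonneg (abs_nonneg x) (by linarith) (by positivity)]
      congr 1; push_cast; ring
    have h2 : |x| ^ (p - 2) ≤ a ^ (p - 2) := Real.rpow_le_rpow (abs_nonneg x) h (by linarith)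
    have h3 : a ^ (2 - p) * a ^ (p - 2) = 1 := by
      rw [← Real.rpow_add ha]; simp
    have h4 : 0 ≤ |x| ^ (p - 2) := by positivity
    have h5 : 0 < a ^ (2 - p) := by positivity
    calc l * |x| ^ p ≤ a ^ (2 - p) / 4 * |x| ^ p := by gcongr
      _ = a ^ (2 - p) / 4 * (|x| ^ (p - 2) * x ^ 2) := by rw [h1]
      _ ≤ a ^ (2 - p) / 4 * (a ^ (p - 2) * x ^ 2) := by gcongr
      _ = a ^ (2 - p) * a ^ (p - 2) * x ^ 2 / 4 := by ring
      _ = x ^ 2 / 4 := by rw [h3, one_mul]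
  · simp; positivity

theorem integrable_exp_truncAbsRpow {a p l : ℝ} (hp : 2 ≤ p) (ha : 0 < a)
    (hl : l ≤ a ^ (2 - p) / 4) :
    Integrable (fun x => Real.exp (l * truncAbsRpow a p x)) stdNormal := by
  refine Integrable.mono' integrable_exp_sq_stdNormal
    ((measurable_truncAbsRpow a p).const_mul l).exp.aestronglyMeasurable (.of_forall fun x => ?_)
  rw [Real.norm_of_nonneg (Real.exp_pos _).le]
  exact Real.exp_le_exp.2 (mul_truncAbsRpow_le hp ha hl x)

theorem integral_exp_truncAbsRpow_le {a p l : ℝ} (hp : 2 ≤ p) (ha : 0 < a) (hl0 : 0 ≤ l)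
    (hl : l ≤ a ^ (2 - p) / 4) :
    ∫ x, Real.exp (l * truncAbsRpow a p x) ∂stdNormal
      ≤ Real.exp (l * ∫ x, |x| ^ p ∂stdNormal
          + l ^ 2 * (4 * 4 ^ p * ∫ x, |x| ^ (2 * (p - 1)) ∂stdNormal)) := by
  have hpt (x : ℝ) : Real.exp (l * truncAbsRpow a p x)
      ≤ 1 + l * |x| ^ p + l ^ 2 * (|x| ^ (2 * p) * Real.exp (x ^ 2 / 4)) := by
    refine (exp_le_one_add_add_sq_mul_exp_abs _).trans ?_
    have h0 := truncAbsRpow_nonneg a p x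
    have h1 := truncAbsRpow_le a p x
    have h2 := mul_truncAbsRpow_le hp ha hl x
    rw [abs_of_nonneg (by positivity), mul_pow, ← abs_rpow_sq, mul_assoc (l ^ 2)]
    gcongr
  have hi1 : Integrable (fun x : ℝ => l * |x| ^ p) stdNormal :=
    (integrable_abs_rpow_stdNormal (by linarith)).const_mul _
  have hi2 : Integrable (fun x : ℝ => l ^ 2 * (|x| ^ (2 * p) * Real.exp (x ^ 2 / 4)))
      stdNormal := (integrable_abs_rpow_mul_exp_stdNormal (by linarith)).const_mul _
  have hi3 : Integrable (fun x : ℝ => 1 + l * |x| ^ p) stdNormal := (integrable_const _).add hi1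
  refine (integral_mono (integrable_exp_truncAbsRpow hp ha hl) (hi3.add hi2) hpt).trans ?_
  simp only [Pi.add_apply]
  rw [integral_add hi3 hi2, integral_add (integrable_const _) hi1, integral_const_mul,
    integral_const_mul]
  simp only [integral_const, probReal_univ, smul_eq_mul, one_mul]
  have := mul_le_mul_of_nonneg_left
    (integral_abs_rpow_mul_exp_stdNormal_le (p := p) (by linarith)) (sq_nonneg l)
  refine le_trans ?_ (Real.add_one_le_exp _)
  linarith

/-- The quadratic bound on `exp (-x)` for `x ≥ 0` has no exponential factor, so no truncation is
needed for the lower tail. -/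
theorem integral_exp_neg_abs_rpow_le {p l : ℝ} (hp : 1 ≤ p) (hl0 : 0 ≤ l) :
    ∫ x, Real.exp (-(l * |x| ^ p)) ∂stdNormal
      ≤ Real.exp (-(l * ∫ x, |x| ^ p ∂stdNormal)
          + l ^ 2 / 2 * (4 * 4 ^ p * ∫ x, |x| ^ (2 * (p - 1)) ∂stdNormal)) := by
  have hpt (x : ℝ) : Real.exp (-(l * |x| ^ p))
      ≤ 1 - l * |x| ^ p + l ^ 2 / 2 * (|x| ^ (2 * p) * Real.exp (x ^ 2 / 4)) := by
    refine (exp_neg_le_quadratic (by positivity)).trans ?_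
    have h1 : 1 ≤ Real.exp (x ^ 2 / 4) := Real.one_le_exp (by positivity)
    have h2 := le_mul_of_one_le_right (show 0 ≤ |x| ^ (2 * p) by positivity) h1
    have h3 := mul_le_mul_of_nonneg_left h2 (show 0 ≤ l ^ 2 / 2 by positivity)
    rw [mul_pow, abs_rpow_sq]
    linarith
  have hi1 : Integrable (fun x : ℝ => l * |x| ^ p) stdNormal :=
    (integrable_abs_rpow_stdNormal (by linarith)).const_mul _
  have hi2 : Integrable (fun x : ℝ => l ^ 2 / 2 * (|x| ^ (2 * p) * Real.exp (x ^ 2 / 4)))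
      stdNormal := (integrable_abs_rpow_mul_exp_stdNormal (by linarith)).const_mul _
  have hi3 : Integrable (fun x : ℝ => 1 - l * |x| ^ p) stdNormal := (integrable_const _).sub hi1
  refine (integral_mono_of_nonneg (.of_forall fun x => (Real.exp_pos _).le) (hi3.add hi2)
    (.of_forall hpt)).trans ?_
  simp only [Pi.add_apply]
  rw [integral_add hi3 hi2, integral_sub (integrable_const _) hi1, integral_const_mul,
    integral_const_mul]
  simp only [integral_const, probReal_univ, smul_eq_mul, one_mul]
  have := mul_le_mul_of_nonneg_left
    (integral_abs_rpow_mul_exp_stdNormal_le (p := p) (by linarith))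
    (show 0 ≤ l ^ 2 / 2 by positivity)
  refine le_trans ?_ (Real.add_one_le_exp _)
  linarith

theorem stdNormalPi_sum_abs_rpow_lower {n : ℕ} {p t R : ℝ} (hp : 1 ≤ p) (ht : 0 ≤ t) (hR : 0 < R)
    (hR2 : n * (4 * 4 ^ p * ∫ x, |x| ^ (2 * (p - 1)) ∂stdNormal) ≤ R ^ 2) :
    (stdNormalPi n).real {x | t * R ≤ n * ∫ y, |y| ^ p ∂stdNormal - ∑ i, |x i| ^ p}
      ≤ Real.exp (-t ^ 2 / 2) := by
  set m := ∫ y, |y| ^ p ∂stdNormal with hm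
  set B := 4 * 4 ^ p * ∫ x, |x| ^ (2 * (p - 1)) ∂stdNormal with hB
  set l := t / R with hl
  have hl0 : 0 ≤ l := by positivity
  have hlR : l * R = t := by rw [hl]; field_simp
  have hint : Integrable (fun x : ℝ => Real.exp (-(l * |x| ^ p))) stdNormal := by
    refine Integrable.mono' (integrable_const 1) (Measurable.aestronglyMeasurable (by fun_prop))
      (.of_forall fun x => ?_)
    rw [Real.norm_of_nonneg (Real.exp_pos _).le, Real.exp_le_one_iff, neg_nonpos]
    positivity
  have h1 := stdNormalPi_chernoff (n := n) hint (l * (t * R - n * m))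
  refine (measureReal_mono (fun x hx => ?_)).trans (h1.trans ?_)
  · simp only [Set.mem_ofPred_eq] at hx ⊢
    rw [Finset.sum_neg_distrib, ← Finset.mul_sum, ← mul_neg]
    exact mul_le_mul_of_nonneg_left (by linarith) hl0
  · have h2 := pow_le_pow_left₀ (integral_nonneg fun x => (Real.exp_pos _).le)
      (integral_exp_neg_abs_rpow_le hp hl0) n
    refine (mul_le_mul_of_nonneg_left h2 (Real.exp_pos _).le).trans ?_
    rw [← Real.exp_nat_mul, ← Real.exp_add, ← hm, ← hB]
    gcongr
    have h3 : l ^ 2 * (n * B) ≤ l ^ 2 * R ^ 2 := by gcongr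
    have h4 : l ^ 2 * R ^ 2 = t ^ 2 := by rw [← mul_pow, hlR]
    have h5 : l * (t * R) = t ^ 2 := by rw [← hlR]; ring
    linarith

theorem stdNormalPi_sum_truncAbsRpow_upper {n : ℕ} {p t R a s : ℝ} (hp : 2 ≤ p) (ht : 0 ≤ t)
    (hR : 0 < R) (ha : 0 < a)
    (hR2 : 2 * (n * (4 * 4 ^ p * ∫ x, |x| ^ (2 * (p - 1)) ∂stdNormal)) ≤ R ^ 2)
    (hs : t * R ≤ s) (has : 4 * t ^ 2 ≤ a ^ (2 - p) * s) :
    (stdNormalPi n).real {x | s ≤ ∑ i, truncAbsRpow a p (x i) - n * ∫ y, |y| ^ p ∂stdNormal}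
      ≤ Real.exp (-t ^ 2 / 2) := by
  set m := ∫ y, |y| ^ p ∂stdNormal with hm
  set B := 4 * 4 ^ p * ∫ x, |x| ^ (2 * (p - 1)) ∂stdNormal with hB
  have hs0 : 0 ≤ s := le_trans (by positivity) hs
  -- The witness is the minimum of `t / R` and the largest admissible parameter. In the second case
  -- `has` gives `t ^ 2 ≤ l * s`, and `l * R ≤ t` gives `l ^ 2 * R ^ 2 ≤ l * s`.
  obtain ⟨l, hl0, hl, hls⟩ : ∃ l : ℝ, 0 ≤ l ∧ l ≤ a ^ (2 - p) / 4 ∧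
      l ^ 2 * R ^ 2 / 2 + t ^ 2 / 2 ≤ l * s := by
    rcases le_total (t / R) (a ^ (2 - p) / 4) with h | h
    · refine ⟨t / R, by positivity, h, ?_⟩
      have h1 : t / R * R = t := by field_simp
      have h2 : t / R * (t * R) ≤ t / R * s := by gcongr
      have h3 : (t / R) ^ 2 * R ^ 2 = t ^ 2 := by rw [← mul_pow, h1]
      have h4 : t / R * (t * R) = t ^ 2 := by field_simp
      linarith
    · refine ⟨a ^ (2 - p) / 4, by positivity, le_rfl, ?_⟩
      set l := a ^ (2 - p) / 4
      have hl0 : 0 ≤ l := by positivity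
      have h1 : l * R ≤ t := by rwa [le_div_iff₀ hR] at h
      have h2 : l * R * (l * R) ≤ l * R * t := by gcongr
      have h3 : l * (t * R) ≤ l * s := by gcongr
      have h4 : t ^ 2 ≤ l * s := by simp only [l]; linarith
      nlinarith
  have h1 := stdNormalPi_chernoff (n := n) (integrable_exp_truncAbsRpow hp ha hl)
    (l * (s + n * m))
  refine (measureReal_mono (fun x hx => ?_)).trans (h1.trans ?_)
  · simp only [Set.mem_ofPred_eq] at hx ⊢
    rw [← Finset.mul_sum]
    exact mul_le_mul_of_nonneg_left (by linarith) hl0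
  · have h2 := pow_le_pow_left₀ (integral_nonneg fun x => (Real.exp_pos _).le)
      (integral_exp_truncAbsRpow_le hp ha hl0 hl) n
    refine (mul_le_mul_of_nonneg_left h2 (Real.exp_pos _).le).trans ?_
    rw [← Real.exp_nat_mul, ← Real.exp_add, ← hm, ← hB]
    gcongr
    have h3 : l ^ 2 * (2 * (n * B)) ≤ l ^ 2 * R ^ 2 := by gcongr
    linarith

theorem stdNormalPi_exists_abs_gt {n : ℕ} {a : ℝ} (ha : 0 ≤ a) :
    (stdNormalPi n).real {x | ∃ i, a < |x i|} ≤ n * (2 * Real.exp (-a ^ 2 / 2)) := by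
  have h : {x : Fin n → ℝ | ∃ i, a < |x i|} = ⋃ i, {x | a < |x i|} := by
    ext x; simp
  rw [h]
  refine (measureReal_iUnion_fintype_le _).trans ?_
  have hi (i : Fin n) : (stdNormalPi n).real {x | a < |x i|} = stdNormal.real {x | a < |x|} := by
    have hm := (measurePreserving_eval (fun _ : Fin n => stdNormal) i).measureReal_preimage
      (s := {x | a < |x|}) (measurableSet_lt (by fun_prop) (by fun_prop)).nullMeasurableSet
    exact hm
  simp only [hi, Finset.sum_const, Finset.card_univ, Fintype.card_fin, nsmul_eq_mul]
  gcongr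
  exact stdNormal_abs_gt_le ha

/-- If `a ≤ 2 * t`, the term `t ^ p` suffices. Otherwise `3 * t ^ 2 ≤ 2 * log n`, so the Gaussian
weight at `a / 2` in the moment lower bound is at least `1 / n`, and `√n` times the root of the
moment dominates `(a / 2) ^ (p - 1) / 3`. -/
theorem le_rpow_mul_max_of_level {n : ℕ} (hn : 0 < n) {p t a : ℝ} (hp : 2 ≤ p) (ht : 0 < t)
    (ha : 0 < a) (ha2 : a ^ 2 = t ^ 2 + 2 * Real.log n) :
    4 * t ^ 2 ≤ a ^ (2 - p) * (3 * 2 ^ p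
      * max (√(∫ x, |x| ^ (2 * (p - 1)) ∂stdNormal) * √n * t) (t ^ p)) := by
  have hn' : (0 : ℝ) < n := by exact_mod_cast hn
  rcases le_or_gt a (2 * t) with h | h
  · have h1 : (2 * t) ^ (2 - p) ≤ a ^ (2 - p) :=
      Real.rpow_le_rpow_of_nonpos ha h (by linarith)
    have h2 : (2 * t) ^ (2 - p) * (2 ^ p * t ^ p) = 4 * t ^ 2 := by
      rw [← Real.mul_rpow two_pos.le ht.le, ← Real.rpow_add (by positivity)]
      rw [show 2 - p + p = (2 : ℕ) by push_cast; ring, Real.rpow_natCast]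
      ring
    calc 4 * t ^ 2 ≤ 3 * (4 * t ^ 2) := by nlinarith [sq_nonneg t]
      _ = (2 * t) ^ (2 - p) * (3 * 2 ^ p * t ^ p) := by rw [← h2]; ring
      _ ≤ _ := by gcongr; exact le_max_right _ _
  · have hlog : 3 * t ^ 2 ≤ 2 * Real.log n := by nlinarith
    have h1 := integral_abs_rpow_stdNormal_lower (q := 2 * (p - 1)) (u := a / 2)
      (by linarith) (by positivity)
    set v := ∫ x, |x| ^ (2 * (p - 1)) ∂stdNormal
    have h2 : 1 / (n : ℝ) ≤ Real.exp (-(3 / 2) * (a / 2) ^ 2) := by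
      rw [one_div, ← Real.exp_log (inv_pos.2 hn'), Real.log_inv]
      exact Real.exp_le_exp.2 (by nlinarith)
    have h3 : 1 / 9 ≤ (√(2 * Real.pi))⁻¹ * Real.exp (-(3 / 4)) := by
      have h4 : √(2 * Real.pi) ≤ 3 := by
        rw [Real.sqrt_le_left (by norm_num)]; linarith [Real.pi_lt_d2]
      have h5 : Real.exp (3 / 4) ≤ 3 :=
        (Real.exp_le_exp.2 (by norm_num)).trans (Real.exp_one_lt_d9.le.trans (by norm_num))
      rw [Real.exp_neg, ← mul_inv, one_div]
      refine inv_anti₀ (by positivity) ?_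
      calc √(2 * Real.pi) * Real.exp (3 / 4) ≤ 3 * 3 := by gcongr
        _ = 9 := by norm_num
    have h4 : 1 / 9 * ((a / 2) ^ (2 * (p - 1)) * (1 / n)) ≤ v := le_trans (by gcongr) h1
    have h5 : ((a / 2) ^ (p - 1) / 3) ^ 2 ≤ v * n := by
      rw [mul_comm 2 (p - 1), show (2 : ℝ) = (2 : ℕ) by norm_num,
        Real.rpow_mul_natCast (by positivity)] at h4
      push_cast at h4
      have := mul_le_mul_of_nonneg_right h4 hn'.le
      refine le_trans (le_of_eq ?_) this
      field_simp
      norm_num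
    have h6 : (a / 2) ^ (p - 1) / 3 ≤ √v * √n := by
      rw [← Real.sqrt_mul' _ hn'.le]
      exact Real.le_sqrt_of_sq_le h5
    have h7 : a ^ (2 - p) * (2 ^ p * (a / 2) ^ (p - 1)) = 2 * a := by
      rw [Real.div_rpow ha.le two_pos.le, Real.rpow_sub_one two_pos.ne']
      have : a ^ (2 - p) * a ^ (p - 1) = a := by
        rw [← Real.rpow_add ha]; norm_num
      have h8 : (0 : ℝ) < 2 ^ p := by positivity
      field_simp
      linarith
    calc 4 * t ^ 2 ≤ 2 * a * t := by nlinarith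
      _ = a ^ (2 - p) * (3 * 2 ^ p * ((a / 2) ^ (p - 1) / 3 * t)) := by rw [← h7]; ring
      _ ≤ a ^ (2 - p) * (3 * 2 ^ p * (√v * √n * t)) := by gcongr
      _ ≤ _ := by gcongr; exact le_max_left _ _

theorem stdNormalPi_concentration_of_two_le {n : ℕ} (hn : 0 < n) {p t : ℝ} (hp : 2 ≤ p)
    (ht : 0 < t) :
    (stdNormalPi n).real {x | 3 * 2 ^ p
        * max (√(∫ x, |x| ^ (2 * (p - 1)) ∂stdNormal) * √n * t) (t ^ p)
        < |∑ i, |x i| ^ p - n * ∫ y, |y| ^ p ∂stdNormal|}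
      ≤ 4 * Real.exp (-t ^ 2 / 2) := by
  have hn' : (0 : ℝ) < n := by exact_mod_cast hn
  have hlog : 0 ≤ Real.log n := Real.log_natCast_nonneg n
  set m := ∫ y, |y| ^ p ∂stdNormal with hm
  set a := √(t ^ 2 + 2 * Real.log n) with ha
  have ha2 : a ^ 2 = t ^ 2 + 2 * Real.log n := Real.sq_sqrt (by positivity)
  have ha0 : 0 < a := Real.sqrt_pos.2 (by positivity)
  have has := le_rpow_mul_max_of_level hn hp ht ha0 ha2
  have hv0 : 0 < ∫ x, |x| ^ (2 * (p - 1)) ∂stdNormal :=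
    lt_of_lt_of_le (by positivity)
      (integral_abs_rpow_stdNormal_lower (q := 2 * (p - 1)) (u := 1) (by linarith) zero_le_one)
  set v := ∫ x, |x| ^ (2 * (p - 1)) ∂stdNormal with hv
  set s := 3 * 2 ^ p * max (√v * √n * t) (t ^ p) with hs
  set R := 3 * 2 ^ p * (√v * √n) with hR
  have hR0 : 0 < R := by positivity
  -- The factor `3` makes `R ^ 2` exceed the `8 * n * 4 ^ p * v` that the upper tail requires.
  have hRsq : R ^ 2 = 9 * (n * (4 ^ p * v)) := by
    have h4 : ((2 : ℝ) ^ p) ^ 2 = 4 ^ p := by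
      rw [← Real.rpow_mul_natCast two_pos.le, mul_comm, Real.rpow_natCast_mul two_pos.le]
      norm_num
    rw [hR, mul_pow, mul_pow, mul_pow, h4, Real.sq_sqrt hv0.le, Real.sq_sqrt hn'.le]
    ring
  have hpos : 0 ≤ n * (4 ^ p * v) := by positivity
  have hRs : t * R ≤ s := by
    have : R * t ≤ s := by
      rw [hR, hs, mul_assoc (3 * 2 ^ p)]; gcongr; exact le_max_left _ _
    linarith
  have hlow := stdNormalPi_sum_abs_rpow_lower (n := n) (p := p) (by linarith) ht.le hR0
    (by linarith)
  have hup := stdNormalPi_sum_truncAbsRpow_upper (n := n) hp ht.le hR0 ha0 (by linarith) hRs has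
  have hmax := stdNormalPi_exists_abs_gt (n := n) ha0.le
  have hexp : n * (2 * Real.exp (-a ^ 2 / 2)) = 2 * Real.exp (-t ^ 2 / 2) := by
    rw [ha2, show -(t ^ 2 + 2 * Real.log n) / 2 = -t ^ 2 / 2 + -Real.log n by ring, Real.exp_add,
      Real.exp_neg, Real.exp_log hn']
    field_simp
  rw [hexp] at hmax
  refine (measureReal_mono (s₂ := ({x | t * R ≤ n * m - ∑ i, |x i| ^ p}
    ∪ {x | s ≤ ∑ i, truncAbsRpow a p (x i) - n * m}) ∪ {x | ∃ i, a < |x i|})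
    (fun x hx => ?_)).trans
    ((measureReal_union_le _ _).trans
      (le_trans (add_le_add_left (measureReal_union_le _ _) _) (by linarith)))
  by_cases hex : ∃ i, a < |x i|
  · exact Or.inr hex
  refine Or.inl ?_
  push Not at hex
  have hY : ∑ i, truncAbsRpow a p (x i) = ∑ i, |x i| ^ p :=
    Finset.sum_congr rfl fun i _ => by simp [truncAbsRpow, hex i]
  simp only [Set.mem_ofPred_eq] at hx
  rcases lt_abs.1 hx with h | h
  · exact Or.inr (by simp only [Set.mem_ofPred_eq]; rw [hY]; exact h.le)
  · exact Or.inl (by simp only [Set.mem_ofPred_eq]; linarith)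

/-! ### From the mean to the median -/

/-- For `t < 3` the claimed probability bound is negative. For `t ≥ 3`, `4 * exp (-9 / 2) < 1 / 2`
forces `|m - c| ≤ D 3 ≤ D t`, and the triangle inequality gives `2 * D t`. -/
theorem IsMedian.concentration {Ω : Type*} [MeasurableSpace Ω] {P : Measure Ω}
    [IsProbabilityMeasure P] {X : Ω → ℝ} {m c : ℝ} {D : ℝ → ℝ} (hm : IsMedian X P m)
    (hD : MonotoneOn D (Set.Ioi 0))
    (h : ∀ t, 0 < t → P.real {ω | D t < |X ω - c|} ≤ 4 * Real.exp (-t ^ 2 / 2))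
    {t W : ℝ} (ht : 0 < t) (hW : 2 * D t ≤ W) :
    1 - 1000 * Real.exp (-t ^ 2 / 2) ≤ P.real {ω | |X ω - m| ≤ W} := by
  rcases lt_or_ge t 3 with h3 | h3
  · have h1 : Real.exp (-1) ^ 5 ≤ Real.exp (-t ^ 2 / 2) := by
      rw [← Real.exp_nat_mul]
      exact Real.exp_le_exp.2 (by push_cast; nlinarith)
    have h2 : (1 / 3 : ℝ) ^ 5 ≤ Real.exp (-1) ^ 5 := by
      have := Real.exp_neg_one_gt_d9
      gcongr
      linarith
    have h4 : 0 ≤ P.real {ω | |X ω - m| ≤ W} := measureReal_nonneg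
    norm_num at h2
    linarith
  · have hexp : 4 * Real.exp (-(3 : ℝ) ^ 2 / 2) < 1 / 2 := by
      have h1 : Real.exp (-(3 : ℝ) ^ 2 / 2) ≤ Real.exp (-1) ^ 4 := by
        rw [← Real.exp_nat_mul]
        exact Real.exp_le_exp.2 (by norm_num)
      have h2 : Real.exp (-1) ^ 4 ≤ (0.37 : ℝ) ^ 4 := by
        have := Real.exp_neg_one_lt_d9
        gcongr
        linarith
      norm_num at h2
      linarith
    have hmc : |m - c| ≤ D 3 := by
      by_contra hcon
      push Not at hcon
      have hsmall := h 3 (by norm_num)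
      rcases lt_abs.1 hcon with h1 | h1
      · have : P.real {ω | m ≤ X ω} ≤ P.real {ω | D 3 < |X ω - c|} :=
          measureReal_mono fun ω hω => by
            simp only [Set.mem_ofPred_eq] at hω ⊢
            exact lt_abs.2 (Or.inl (by linarith))
        linarith [hm.2]
      · have : P.real {ω | X ω ≤ m} ≤ P.real {ω | D 3 < |X ω - c|} :=
          measureReal_mono fun ω hω => by
            simp only [Set.mem_ofPred_eq] at hω ⊢
            exact lt_abs.2 (Or.inr (by linarith))
        linarith [hm.1]
    have hD3 : D 3 ≤ D t := hD (by norm_num) ht h3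
    have hcover : Set.univ ⊆ {ω | |X ω - m| ≤ W} ∪ {ω | D t < |X ω - c|} := by
      intro ω _
      by_cases hω : D t < |X ω - c|
      · exact Or.inr hω
      · refine Or.inl ?_
        simp only [Set.mem_ofPred_eq]
        have := abs_sub_le (X ω) c m
        rw [abs_sub_comm c m] at this
        linarith
    have h1 := (measureReal_mono (μ := P) hcover).trans (measureReal_union_le _ _)
    rw [probReal_univ] at h1
    linarith [h t ht, Real.exp_pos (-t ^ 2 / 2)]

/-! ### Transfer to the Gaussian vector and assembly of the four ranges -/

theorem measureReal_stdGaussian_law {n : ℕ} {Ω : Type*} [MeasurableSpace Ω] {P : Measure Ω}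
    {Z : Ω → EuclideanSpace ℝ (Fin n)}
    (hZ : HasLaw Z (stdGaussian (EuclideanSpace ℝ (Fin n))) P) (p c d : ℝ) :
    P.real {ω | d < |∑ i, |Z ω i| ^ p - c|}
      = (stdNormalPi n).real {x | d < |∑ i, |x i| ^ p - c|} := by
  have hmeas : MeasurableSet {x : EuclideanSpace ℝ (Fin n) | d < |∑ i, |x i| ^ p - c|} :=
    measurableSet_lt (by fun_prop) (by fun_prop)
  have h1 : P.real {ω | d < |∑ i, |Z ω i| ^ p - c|}
      = (P.map Z).real {x | d < |∑ i, |x i| ^ p - c|} := by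
    rw [map_measureReal_apply_of_aemeasurable hZ.aemeasurable hmeas]; rfl
  rw [h1, hZ.map_eq, ← map_pi_eq_stdGaussian, map_measureReal_apply (by fun_prop) hmeas]
  rfl

theorem integral_coord_stdGaussian_law {n : ℕ} {Ω : Type*} [MeasurableSpace Ω] {P : Measure Ω}
    {Z : Ω → EuclideanSpace ℝ (Fin n)}
    (hZ : HasLaw Z (stdGaussian (EuclideanSpace ℝ (Fin n))) P) (i : Fin n) (q : ℝ) :
    ∫ ω, |Z ω i| ^ q ∂P = ∫ x, |x| ^ q ∂stdNormal := by
  have h1 := hZ.integral_comp (f := fun x => |x i| ^ q)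
    (Measurable.aestronglyMeasurable (by fun_prop))
  rw [← map_pi_eq_stdGaussian, integral_map (by fun_prop)
    (Measurable.aestronglyMeasurable (by fun_prop))] at h1
  refine h1.trans ?_
  rw [← (measurePreserving_eval (fun _ : Fin n => stdNormal) i).map_eq,
    integral_map (measurable_pi_apply i).aemeasurable
      (Measurable.aestronglyMeasurable (by fun_prop))]

theorem mul_div_sqrt_rpow {n t : ℝ} (hn : 0 < n) (ht : 0 ≤ t) (r : ℝ) :
    n * (t / √n) ^ r = n ^ (1 - r / 2) * t ^ r := by
  rw [Real.div_rpow ht (Real.sqrt_nonneg n), Real.sqrt_eq_rpow, ← Real.rpow_mul hn.le,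
    Real.rpow_sub hn, Real.rpow_one, show 1 / 2 * r = r / 2 by ring]
  ring

theorem mainTheorem10 :
    ∃ C : ℝ, 0 < C ∧
      ∀ (n : ℕ) (hn : 0 < n) (p : ℝ), 0 < p →
      ∀ {Ω : Type*} [MeasurableSpace Ω] (P : Measure Ω) [IsProbabilityMeasure P]
        (Z : Ω → EuclideanSpace ℝ (Fin n)),
        HasLaw Z (stdGaussian (EuclideanSpace ℝ (Fin n))) P →
      ∀ m : ℝ, IsMedian (fun ω => ∑ i, |Z ω i| ^ p) P m →
      ∀ t : ℝ, 0 < t →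
        (p ≤ 1 →
          1 - C * Real.exp (-t ^ 2 / 2) ≤
            P.real {ω | |(∑ i, |Z ω i| ^ p) - m| ≤ C * (n : ℝ) ^ (1 / 2 : ℝ) * t}) ∧
        (1 ≤ p → p ≤ 3 / 2 →
          1 - C * Real.exp (-t ^ 2 / 2) ≤
            P.real {ω | |(∑ i, |Z ω i| ^ p) - m| ≤
              C * (n : ℝ) ^ (1 / 2 : ℝ) * t + C * (n : ℝ) ^ (1 / 4 : ℝ) * t ^ (3 / 2 : ℝ)}) ∧
        (3 / 2 ≤ p → p ≤ 2 →
          1 - C * Real.exp (-t ^ 2 / 2) ≤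
            P.real {ω | |(∑ i, |Z ω i| ^ p) - m| ≤
              C * (n : ℝ) ^ (1 / 2 : ℝ) * t + C * (n : ℝ) ^ (1 - p / 2) * t ^ p}) ∧
        (2 ≤ p →
          1 - C * Real.exp (-t ^ 2 / 2) ≤
            P.real {ω | |(∑ i, |Z ω i| ^ p) - m| ≤
              C * 2 ^ p *
                max ((∫ ω', |Z ω' ⟨0, hn⟩| ^ (2 * (p - 1)) ∂P) ^ (1 / 2 : ℝ)
                      * (n : ℝ) ^ (1 / 2 : ℝ) * t)
                    (t ^ p)}) := by
  refine ⟨1000, by norm_num, ?_⟩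
  intro n hn p hp Ω _ P _ Z hZ m hm t ht
  have hn' : (0 : ℝ) < n := by exact_mod_cast hn
  have hu : 0 < t / √n := by positivity
  have e1 : (n : ℝ) * (t / √n) = n ^ (1 / 2 : ℝ) * t := by
    have := mul_div_sqrt_rpow hn' ht.le 1
    norm_num at this ⊢
    exact this
  have hsmall (hp2 : p ≤ 2) {W : ℝ}
      (hW : 2 * (130 * n * max (t / √n) ((t / √n) ^ max p 1)) ≤ W) :
      1 - 1000 * Real.exp (-t ^ 2 / 2) ≤ P.real {ω | |(∑ i, |Z ω i| ^ p) - m| ≤ W} := by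
    refine hm.concentration (c := n * ∫ y, |y| ^ p ∂stdNormal)
      (D := fun t => 130 * n * max (t / √n) ((t / √n) ^ max p 1)) ?_ ?_ ht hW
    · intro s hs t _ hst
      have : 0 < s := hs
      dsimp only
      gcongr
    · intro t ht
      rw [measureReal_stdGaussian_law hZ]
      exact (stdNormalPi_concentration_of_le_two hn hp.le hp2 ht).trans
        (by linarith [Real.exp_pos (-t ^ 2 / 2)])
  have hmax (r : ℝ) (hr1 : 1 ≤ r) : n * max (t / √n) ((t / √n) ^ r)
      ≤ n ^ (1 / 2 : ℝ) * t + n ^ (1 - r / 2) * t ^ r := by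
    rw [← e1, ← mul_div_sqrt_rpow hn' ht.le r, ← mul_add]
    gcongr
    exact max_le_add_of_nonneg hu.le (by positivity)
  have h0 : 0 ≤ (n : ℝ) ^ (1 / 2 : ℝ) * t := by positivity
  refine ⟨fun h => ?_, fun h1 h => ?_, fun h1 h => ?_, fun h => ?_⟩
  · refine hsmall (by linarith) ?_
    rw [max_eq_right h, Real.rpow_one, max_self]
    linarith
  · refine hsmall (by linarith) ?_
    -- For `1 ≤ p ≤ 3 / 2` the power `u ^ p` lies below `u` if `u ≤ 1` and below `u ^ (3 / 2)` if `u
    -- ≥ 1`.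
    have h2 : max (t / √n) ((t / √n) ^ p) ≤ max (t / √n) ((t / √n) ^ (3 / 2 : ℝ)) := by
      rcases le_total (t / √n) 1 with h3 | h3
      · refine max_le (le_max_left _ _) (le_max_of_le_left ?_)
        simpa using Real.rpow_le_rpow_of_exponent_ge hu h3 h1
      · exact max_le_max le_rfl (Real.rpow_le_rpow_of_exponent_le h3 h)
    have h3 := mul_le_mul_of_nonneg_left h2 hn'.le
    have h4 := hmax (3 / 2) (by norm_num)
    rw [show (1 - 3 / 2 / 2 : ℝ) = 1 / 4 by norm_num] at h4
    have h5 : 0 ≤ (n : ℝ) ^ (1 / 4 : ℝ) * t ^ (3 / 2 : ℝ) := by positivity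
    rw [max_eq_left h1]
    linarith
  · refine hsmall h ?_
    have h4 := hmax p (by linarith)
    have h5 : 0 ≤ (n : ℝ) ^ (1 - p / 2) * t ^ p := by positivity
    rw [max_eq_left (by linarith : 1 ≤ p)]
    linarith
  · rw [integral_coord_stdGaussian_law hZ, ← Real.sqrt_eq_rpow, ← Real.sqrt_eq_rpow]
    refine hm.concentration (c := n * ∫ y, |y| ^ p ∂stdNormal)
      (D := fun t => 3 * 2 ^ p
        * max (√(∫ x, |x| ^ (2 * (p - 1)) ∂stdNormal) * √n * t) (t ^ p)) ?_ ?_ ht ?_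
    · intro s hs t _ hst
      have : 0 < s := hs
      dsimp only
      gcongr
    · intro t ht
      rw [measureReal_stdGaussian_law hZ]
      exact stdNormalPi_concentration_of_two_le hn h ht
    · have : 0 ≤ 2 ^ p
        * max (√(∫ x, |x| ^ (2 * (p - 1)) ∂stdNormal) * √n * t) (t ^ p) := by positivity
      linarith
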